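/- Let $m\ge 1$. A \emph{$B$-tree of order $2m+1$} is a search tree (a rooted plane tree whose nodes contain distinct keys in increasing order from left to right, every non-leaf node with $k$ keys having exactly $k+1$ children, separated by these keys) in which all leaves have the same distance to the root and every node contains at least $m$ and at most $2m$ keys, except that the root may contain fewer than $m$ keys (but at least one). A new key is inserted by placing it in the appropriate leaf at the appropriate position; whenever a node then contains $2m+1$ keys, it is split into two nodes with the $m$ lowest and the $m$ largest keys, and the median key moves up into the parent node (into a new root if the root is split). The \emph{history} of a key sequence of length $n$ is the sequence $(T_1,\dots,T_n)$, where $T_k$ is the isomorphism class of the $B$-tree obtained from the first $k$ keys, i.e. this tree with all keys replaced by indistinguishable dots. A \emph{$(2m+1)$-historic tree} $H_n$ is a rooted plane tree on $n$ vertices, labelled by $\{1,\dots,n\}$ increasingly along each path from the root, such that each vertex at one of the heights $2m, 3m+1, 4m+2,\dots$ has two positions for children (a left and a right one) and every other vertex has one, each of which may or may not be occupied. The vertices of $H_n$ (called internal) at these heights are the \emph{branchings}; the unoccupied positions are the \emph{external vertices}, ordered from left to right. Let $H_k$ be the subtree of $H_n$ of the vertices with labels at most $k$. The tree $H_n$ \emph{encodes}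 the history $(T_1,\dots,T_n)$ in which $T_1$ is a single node with one key and, for $1\le k<n$, $T_{k+1}$ is obtained from $T_k$ by inserting a key into the $i$-th leaf of $T_k$ from the left, where the vertex $k+1$ is attached to $H_k$ at the $i$-th external vertex of $H_k$ from the left. Let $H_n$ be a $(2m+1)$-historic tree with $b\ge 1$ branchings. Then $H_n$ has exactly $b+1$ external vertices. For $1\le i\le b+1$, let $s_i$ be the number of internal vertices of $H_n$ strictly between the $i$-th external vertex and the closest branching above it, and let $\underline{\pi}(H_n)$ be the set of permutations $\pi$ of $\{1,\dots,n\}$ such that the key sequence $\pi(1),\dots,\pi(n)$ has the history encoded by $H_n$. Then \[ |\underline{\pi}(H_n)|=\left(\frac{(2m+1)!}{(m!)^2}\right)^b\cdot\prod_{i=1}^{b+1}(m+s_i)!. \] -/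

import Mathlib

open scoped Nat

namespace BTreeHistory

/-! ### Search trees all of whose leaves have the same distance to the root -/

/-- Rooted plane trees of height `h` all of whose leaves are at distance `h` from the root, with
entries (keys) from `α` in their nodes. A leaf is the list of its keys, from left to right. A
non-leaf node with `k` keys has `k + 1` children: it consists of its leftmost child, followed by
the list of its keys, each paired with the child immediately to the right of that key. -/
def Level (α : Type) : ℕ → Type
  | 0 => List α
  | h + 1 => Level α h × List (α × Level α h)

/-- A tree of some height. -/
abbrev KeyTree (α : Type) : Type := Σ h : ℕ, Level α h

/-- The tree whose only node is an empty leaf. -/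
def emptyTree (α : Type) : KeyTree α := ⟨0, ([] : List α)⟩

/-- The number of leaves. -/
def Level.leaves {α : Type} : (h : ℕ) → Level α h → ℕ
  | 0, _ => 1
  | h + 1, t => Level.leaves h t.1 + (t.2.map fun p => Level.leaves h p.2).sum

/-- Replace every key `k` by `f k`. -/
def Level.map {α β : Type} (f : α → β) : (h : ℕ) → Level α h → Level β h
  | 0, l => List.map f l
  | h + 1, t => (Level.map f h t.1, t.2.map fun p => (f p.1, Level.map f h p.2))

/-- The isomorphism class of a tree: all keys are replaced by (indistinguishable) dots. -/
def shape {α : Type} (T : KeyTree α) : KeyTree Unit :=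
  ⟨T.1, Level.map (fun _ => ()) T.1 T.2⟩

/-! ### The insertion algorithm for order `2 * m + 1` -/

/-- What becomes of a node (with its subtree) under an insertion: it stays a single node, or it
is split into two nodes, with a key between them that moves up into the parent. -/
inductive Grown (α β : Type) : Type
  | single (t : β) : Grown α β
  | split (l : β) (k : α) (r : β) : Grown α β

/-- Split a leaf that holds more than `2 * m` keys: the lowest `m` keys form a leaf, the next
one moves up, the remaining ones form a leaf. -/
def splitLeaf {α : Type} (m : ℕ) (l : List α) : Grown α (List α) :=
  if l.length ≤ 2 * m then .single l
  else
    match l.drop m with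
    | [] => .single l
    | k :: r => .split (l.take m) k r

/-- Split a non-leaf node that holds more than `2 * m` keys: the lowest `m` keys form a node, the
next one moves up, the remaining ones form a node. -/
def splitNode {α β : Type} (m : ℕ) (t : β × List (α × β)) : Grown α (β × List (α × β)) :=
  if t.2.length ≤ 2 * m then .single t
  else
    match t.2.drop m with
    | [] => .single t
    | (k, d) :: r => .split (t.1, t.2.take m) k (d, r)

/-- Put the result of an insertion into a child back into the parent; `rest` is the part of the
parent to the right of this child. -/
def absorb {α β : Type} (g : Grown α β) (rest : List (α × β)) : β × List (α × β) :=
  match g with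
  | .single t => (t, rest)
  | .split l k r => (l, (k, r) :: rest)

/-- Apply `f` to the child that contains the leaf with index `i` (counted from `0` from left to
right); `leaves` counts the leaves below a child. -/
def updateChild {α β : Type} (leaves : β → ℕ) (f : ℕ → β → Grown α β) :
    ℕ → β → List (α × β) → β × List (α × β)
  | i, c, [] => absorb (f i c) []
  | i, c, (k, d) :: rest =>
    if i < leaves c then absorb (f i c) ((k, d) :: rest)
    else
      let q := updateChild leaves f (i - leaves c) d rest
      (c, (k, q.1) :: q.2)

/-- Apply `put` to the list of keys of the leaf with index `i`, and perform all necessary splits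
at and below the given node. -/
def Level.insertAt {α : Type} (m : ℕ) (put : List α → List α) :
    (h : ℕ) → ℕ → Level α h → Grown α (Level α h)
  | 0, _, l => splitLeaf m (put l)
  | h + 1, i, t =>
    splitNode m (updateChild (Level.leaves h) (Level.insertAt m put h) i t.1 t.2)

/-- Apply `put` to the list of keys of the leaf with index `i`, and perform all necessary splits.
If the root is split, then a new root with a single key is created. -/
def insertAt {α : Type} (m : ℕ) (put : List α → List α) (i : ℕ) (T : KeyTree α) : KeyTree α :=
  match Level.insertAt m put T.1 i T.2 with
  | .single t => ⟨T.1, t⟩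
  | .split l k r => ⟨T.1 + 1, (l, [(k, r)])⟩

/-- Search for the leaf in which `x` belongs, at a non-leaf node; `find` is the search at a
child, `leaves` counts the leaves below a child. -/
def findChild {α β : Type} [LinearOrder α] (leaves : β → ℕ) (find : β → ℕ) (x : α) :
    β → List (α × β) → ℕ
  | c, [] => find c
  | c, (k, d) :: rest =>
    if x < k then find c else leaves c + findChild leaves find x d rest

/-- The index (counted from `0` from left to right) of the leaf in which the key `x` belongs. -/
def Level.leafIndex {α : Type} [LinearOrder α] (x : α) : (h : ℕ) → Level α h → ℕ
  | 0, _ => 0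
  | h + 1, t => findChild (Level.leaves h) (Level.leafIndex x h) x t.1 t.2

/-- The insertion algorithm: `x` is placed in the appropriate leaf at the appropriate position,
and nodes with `2 * m + 1` keys are split. -/
def insertKey {α : Type} [LinearOrder α] (m : ℕ) (T : KeyTree α) (x : α) : KeyTree α :=
  insertAt m (List.orderedInsert (· ≤ ·) x) (Level.leafIndex x T.1 T.2) T

/-- The tree obtained from the empty tree by inserting the given keys one after the other. -/
def build {α : Type} [LinearOrder α] (m : ℕ) (keys : List α) : KeyTree α :=
  keys.foldl (insertKey m) (emptyTree α)

/-- Insertion of a key in the leaf with index `i`, on the level of isomorphism classes. -/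
def insertDot (m : ℕ) (i : ℕ) (T : KeyTree Unit) : KeyTree Unit :=
  insertAt m (List.cons ()) i T

/-- The history produced by the key sequence `π`: its `k`-th member, `1 ≤ k ≤ n`, is the
isomorphism class of the tree after the insertion of the first `k` keys. -/
def permHistory (m : ℕ) {n : ℕ} (π : Equiv.Perm (Fin n)) (k : ℕ) : KeyTree Unit :=
  shape (build m ((List.ofFn π).take k))

/-! ### Historic trees -/

/-- Labelled rooted plane trees, drawn with their external vertices `ext`: an internal vertex has
one position for a child (`plain`) or two, a left and a right one (`branching`), and a position
with no internal vertex in it holds an external vertex. -/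
inductive HTree : Type
  | ext : HTree
  | plain (label : ℕ) (child : HTree) : HTree
  | branching (label : ℕ) (left right : HTree) : HTree

/-- The heights `2m, 3m + 1, 4m + 2, …`. -/
def IsBranchingHeight (m h : ℕ) : Prop := ∃ j : ℕ, h = 2 * m + j * (m + 1)

namespace HTree

/-- For a tree whose root has height `h`: the vertices with two positions for children are
precisely the internal vertices at the heights `2m, 3m + 1, 4m + 2, …`. -/
def HeightCondition (m : ℕ) : ℕ → HTree → Prop
  | _, ext => True
  | h, plain _ c => ¬ IsBranchingHeight m h ∧ HeightCondition m (h + 1) c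
  | h, branching _ l r =>
    IsBranchingHeight m h ∧ HeightCondition m (h + 1) l ∧ HeightCondition m (h + 1) r

/-- The labels of the internal vertices. -/
def labels : HTree → List ℕ
  | ext => []
  | plain a c => a :: c.labels
  | branching a l r => a :: (l.labels ++ r.labels)

/-- The labels increase along each path from the root to a leaf. -/
def Increasing : HTree → Prop
  | ext => True
  | plain a c => (∀ v ∈ c.labels, a < v) ∧ c.Increasing
  | branching a l r =>
    (∀ v ∈ l.labels, a < v) ∧ (∀ v ∈ r.labels, a < v) ∧ l.Increasing ∧ r.Increasing

/-- `H` is a `(2 * m + 1)`-historic tree on `n` vertices, labelled by `1, …, n`. -/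
structure IsHistoric (m n : ℕ) (H : HTree) : Prop where
  nodup : H.labels.Nodup
  mem_labels : ∀ v : ℕ, v ∈ H.labels ↔ 1 ≤ v ∧ v ≤ n
  increasing : H.Increasing
  heightCondition : H.HeightCondition m 0

/-- The number of branchings. -/
def numBranchings : HTree → ℕ
  | ext => 0
  | plain _ c => c.numBranchings
  | branching _ l r => l.numBranchings + r.numBranchings + 1

/-- The number of external vertices. -/
def numExternal : HTree → ℕ
  | ext => 1
  | plain _ c => c.numExternal
  | branching _ l r => l.numExternal + r.numExternal

/-- The list, over all external vertices from left to right, of the number of internal vertices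
strictly between the external vertex and the closest branching above it. Here `s` is the number
of internal vertices met since the last branching (or since the root, as long as there is no
branching; no such external vertex exists in a historic tree with a branching). -/
def spacingsFrom : ℕ → HTree → List ℕ
  | s, ext => [s]
  | s, plain _ c => spacingsFrom (s + 1) c
  | _, branching _ l r => spacingsFrom 0 l ++ spacingsFrom 0 r

/-- The numbers `s₁, s₂, …` of internal vertices strictly between the first, second, … external
vertex and the closest branching above it. -/
def spacings (H : HTree) : List ℕ := spacingsFrom 0 H

/-- The subtree consisting of the vertices with label `≤ k`. -/
def restrict (k : ℕ) : HTree → HTree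
  | ext => ext
  | plain a c => if a ≤ k then plain a (c.restrict k) else ext
  | branching a l r => if a ≤ k then branching a (l.restrict k) (r.restrict k) else ext

/-- The index (counted from `0` from left to right) of the external vertex of `H.restrict k` at
which the vertex with label `k + 1` is attached. -/
def attachIndex (k : ℕ) : HTree → ℕ
  | ext => 0
  | plain a c => if a = k + 1 then 0 else c.attachIndex k
  | branching a l r =>
    if a = k + 1 then 0
    else if k + 1 ∈ l.labels then l.attachIndex k
    else (l.restrict k).numExternal + r.attachIndex k

/-- The history of B-trees of order `2 * m + 1` that is encoded by the historic tree `H`: the tree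
with index `k + 1` arises from the one with index `k` by an insertion in the `i`-th leaf, where
the vertex `k + 1` is attached to the `i`-th external vertex of the subtree of the vertices with
labels `≤ k`. -/
def history (m : ℕ) (H : HTree) : ℕ → KeyTree Unit
  | 0 => emptyTree Unit
  | k + 1 => insertDot m (H.attachIndex k) (history m H k)

/-- The permutations in `S_n` that produce, as key sequences, the history encoded by `H`. -/
def perms (m n : ℕ) (H : HTree) : Set (Equiv.Perm (Fin n)) :=
  {π | ∀ k : ℕ, 1 ≤ k → k ≤ n → permHistory m π k = H.history m k}

end HTree

end BTreeHistory

/-! Only the sizes of the leaves matter. Splitting an inner node moves a separator up but keeps the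
left-to-right sequence of leaves and separators, so the tree can be flattened to that sequence
(`Level.flat_insertAt`). On the list of leaf sizes an insertion turns an entry `c < 2 * m` into `c +
1`, and an entry `2 * m` into `m, m` (`step`). Since `m ≥ 1`, the new list reveals which leaf was
hit (`step_injective`), so prescribing a history is the same as prescribing the leaf at every step.

A new key has `n + 1` possible ranks relative to `n` old keys, and exactly `c + 1` of them lead to a
given leaf with `c` keys (`card_filter_find_eq`). Because the algorithm only compares keys
(`build_map`), the number of permutations with the prescribed history is multiplied by `c + 1` at
each step (`ncard_produces_succ`).

Put `K = (2m+1)! / (m!)²`. The product of `K * c!` over all leaves grows by the same factor `c + 1`: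
this is clear without a split, and with a split it is `K * m! * m! = (2m+1) * (2m)!`
(`weight_step`). Starting from one empty leaf, of weight `K`, the count times `K` is always the
weight.

In the historic tree the external vertices are the leaves, and the branching heights are exactly
those at which a leaf has `2 * m` keys (`sizesFrom_restrict_succ`). At the end the `b + 1` leaves
have sizes `m + sᵢ`, and cancelling one `K` gives the formula. -/

namespace BTreeHistory

/-! ### Flattening a tree -/

/-- The leaves of a tree from left to right, with the keys of the non-leaf nodes that separate
them. -/
abbrev Flat (α : Type) : Type := List α × List (α × List α)

/-- Two flattened trees side by side, separated by a key. -/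
def Flat.glue {α : Type} (t : Flat α) (k : α) (u : Flat α) : Flat α :=
  (t.1, t.2 ++ (k, u.1) :: u.2)

/-- All keys from left to right. -/
def Flat.inorder {α : Type} (t : Flat α) : List α := t.1 ++ t.2.flatMap fun p => p.1 :: p.2

/-- The numbers of keys in the leaves, from left to right. -/
def Flat.sizes {α : Type} (t : Flat α) : List ℕ := t.1.length :: t.2.map fun p => p.2.length

/-- Flatten a node, given the flattening of its children. -/
def flatNode {α β : Type} (fl : β → Flat α) : β → List (α × β) → Flat α
  | c, [] => fl c
  | c, (k, d) :: rest => (fl c).glue k (flatNode fl d rest)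

/-- Flatten a tree. -/
def Level.flat {α : Type} : (h : ℕ) → Level α h → Flat α
  | 0, l => (l, [])
  | h + 1, t => flatNode (Level.flat h) t.1 t.2

/-- Flatten the outcome of an insertion. -/
def Grown.flat {α β : Type} (fl : β → Flat α) : Grown α β → Flat α
  | .single t => fl t
  | .split l k r => (fl l).glue k (fl r)

/-- Replace the leaf with index `i`. -/
def Flat.update {α : Type} (f : List α → Grown α (List α)) (i : ℕ) (t : Flat α) : Flat α :=
  updateChild (fun _ => 1) (fun _ => f) i t.1 t.2

/-- The index of the leaf in which `x` belongs. -/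
def Flat.find {α : Type} [LinearOrder α] (x : α) (t : Flat α) : ℕ :=
  findChild (fun _ => 1) (fun _ => 0) x t.1 t.2

section Flatten

variable {α β : Type}

theorem Flat.glue_assoc (t : Flat α) (k : α) (u : Flat α) (j : α) (v : Flat α) :
    (t.glue k u).glue j v = t.glue k (u.glue j v) := by
  simp [Flat.glue]

theorem Flat.inorder_glue (t : Flat α) (k : α) (u : Flat α) :
    (t.glue k u).inorder = t.inorder ++ k :: u.inorder := by
  simp [Flat.glue, Flat.inorder]

theorem flatNode_append (fl : β → Flat α) (c : β) (rest : List (α × β)) (k : α) (d : β)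
    (rest' : List (α × β)) :
    flatNode fl c (rest ++ (k, d) :: rest') =
      (flatNode fl c rest).glue k (flatNode fl d rest') := by
  induction rest generalizing c with
  | nil => rfl
  | cons p rest ih => simp [flatNode, ih, Flat.glue_assoc]

theorem flatNode_absorb_nil (fl : β → Flat α) (g : Grown α β) :
    flatNode fl (absorb g []).1 (absorb g []).2 = g.flat fl := by
  cases g <;> rfl

theorem flatNode_absorb_cons (fl : β → Flat α) (g : Grown α β) (k : α) (d : β)
    (rest : List (α × β)) :
    flatNode fl (absorb g ((k, d) :: rest)).1 (absorb g ((k, d) :: rest)).2 =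
      (g.flat fl).glue k (flatNode fl d rest) := by
  cases g
  · rfl
  · simp [absorb, flatNode, Grown.flat, Flat.glue_assoc]

/-- The median of an inner node still separates the same two neighbouring leaves after it has moved
up. Hence splits above the leaves are invisible after flattening. -/
theorem flat_splitNode (m : ℕ) (fl : β → Flat α) (t : β × List (α × β)) :
    (splitNode m t).flat (fun t => flatNode fl t.1 t.2) = flatNode fl t.1 t.2 := by
  unfold splitNode
  split_ifs
  · rfl
  · split
    · rfl
    · next k d r h =>
      conv_rhs => rw [← List.take_append_drop m t.2, h]
      rw [flatNode_append]
      rfl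

/-- This is the recursion of `updateChild` at a node of arbitrary height, which is what lets the
descent through the levels collapse to a walk along one list. -/
theorem Flat.update_glue (f : List α → Grown α (List α)) (i : ℕ) (t : Flat α) (k : α)
    (u : Flat α) :
    Flat.update f i (t.glue k u) =
      if i < t.2.length + 1 then (Flat.update f i t).glue k u
      else t.glue k (Flat.update f (i - (t.2.length + 1)) u) := by
  obtain ⟨c, rest⟩ := t
  induction rest generalizing i c with
  | nil =>
    simp only [Flat.update, Flat.glue, List.nil_append, updateChild, List.length_nil]
    split_ifs
    · cases f c <;> rfl
    · rfl
  | cons p rest ih =>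
    obtain ⟨j, d⟩ := p
    by_cases hi : i < 1
    · simp only [Flat.update, Flat.glue, List.cons_append, updateChild, hi, if_true]
      rw [if_pos (by simp; omega)]
      cases f c <;> rfl
    · have := ih (i - 1) d
      simp only [Flat.update, Flat.glue] at this
      simp only [Flat.update, Flat.glue, List.cons_append, updateChild, hi, if_false, this]
      have e : i - 1 < rest.length + 1 ↔ i < ((j, d) :: rest).length + 1 := by simp
      simp only [e]
      have e' : i - 1 - (rest.length + 1) = i - (((j, d) :: rest).length + 1) := by
        simp only [List.length_cons]; omega
      rw [e']
      split_ifs <;> rfl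

theorem Level.leaves_eq (h : ℕ) (t : Level α h) :
    Level.leaves h t = (Level.flat h t).2.length + 1 := by
  induction h with
  | zero => rfl
  | succ h ih =>
    obtain ⟨c, rest⟩ := t
    simp only [Level.leaves, Level.flat, ih]
    induction rest generalizing c with
    | nil => simp [flatNode]
    | cons p rest ih' =>
      have := ih' p.2
      simp only [flatNode, Flat.glue, List.map_cons, List.sum_cons, List.length_append,
        List.length_cons]
      omega

theorem flatNode_updateChild (leaves : β → ℕ) (fl : β → Flat α) (f : ℕ → β → Grown α β)
    (F : List α → Grown α (List α)) (hleaves : ∀ c, leaves c = (fl c).2.length + 1)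
    (hf : ∀ i c, (f i c).flat fl = Flat.update F i (fl c)) (i : ℕ) (c : β)
    (rest : List (α × β)) :
    flatNode fl (updateChild leaves f i c rest).1 (updateChild leaves f i c rest).2 =
      Flat.update F i (flatNode fl c rest) := by
  induction rest generalizing i c with
  | nil => simp [updateChild, flatNode_absorb_nil, hf, flatNode]
  | cons p rest ih =>
    obtain ⟨k, d⟩ := p
    simp only [updateChild, flatNode, Flat.update_glue, hleaves]
    split_ifs
    · rw [flatNode_absorb_cons, hf]
    · simp only [flatNode, ih]

theorem Level.flat_insertAt (m : ℕ) (put : List α → List α) (h i : ℕ) (t : Level α h) :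
    (Level.insertAt m put h i t).flat (Level.flat h) =
      Flat.update (fun l => splitLeaf m (put l)) i (Level.flat h t) := by
  induction h generalizing i with
  | zero =>
    change (splitLeaf m (put t)).flat _ = absorb (splitLeaf m (put t)) []
    cases splitLeaf m (put t) <;> rfl
  | succ h ih =>
    refine (flat_splitNode m (Level.flat h) _).trans ?_
    exact flatNode_updateChild _ _ _ _ (Level.leaves_eq h) ih _ _ _

/-- Flatten a tree of any height. -/
def KeyTree.flat (T : KeyTree α) : Flat α := Level.flat T.1 T.2

theorem KeyTree.flat_insertAt (m : ℕ) (put : List α → List α) (i : ℕ) (T : KeyTree α) :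
    KeyTree.flat (insertAt m put i T) =
      Flat.update (fun l => splitLeaf m (put l)) i (KeyTree.flat T) := by
  rw [KeyTree.flat, KeyTree.flat, ← Level.flat_insertAt, insertAt]
  cases Level.insertAt m put T.1 i T.2 <;> rfl

/-! ### Searching -/

theorem Flat.mem_inorder_of_separator {t : Flat α} {p : α × List α} (hp : p ∈ t.2) :
    p.1 ∈ t.inorder := by
  simp only [Flat.inorder, List.mem_append, List.mem_flatMap]
  exact Or.inr ⟨p, hp, by simp⟩

theorem inorder_absorb_splitLeaf (m : ℕ) (l : List α) (rest : List (α × List α)) :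
    Flat.inorder (absorb (splitLeaf m l) rest) = Flat.inorder (l, rest) := by
  unfold splitLeaf
  split_ifs
  · rfl
  · split
    · rfl
    · next k r h =>
      conv_rhs => rw [← List.take_append_drop m l, h]
      simp [absorb, Flat.inorder]

variable [LinearOrder α]

/-- The linear search meets the separators of `t` before `k`. If `x` is not below `k`, it must pass
all of them, which is where `ht` is needed. -/
theorem Flat.find_glue (x : α) (t : Flat α) (k : α) (u : Flat α) (ht : ∀ p ∈ t.2, p.1 < k) :
    (t.glue k u).find x = if x < k then t.find x else t.2.length + 1 + u.find x := by
  obtain ⟨c, rest⟩ := t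
  induction rest generalizing c with
  | nil => simp [Flat.find, Flat.glue, findChild]
  | cons p rest ih =>
    obtain ⟨j, d⟩ := p
    have := ih d fun p hp => ht p (by simp_all)
    have hj : j < k := ht (j, d) (by simp)
    simp only [Flat.find, Flat.glue] at this
    simp only [Flat.find, Flat.glue, List.cons_append, findChild, this]
    split_ifs with h1 h2 h2
    · rfl
    · exact absurd (h1.trans hj) h2
    · rfl
    · simp only [List.length_cons]; omega

theorem findChild_eq_find (leaves : β → ℕ) (fl : β → Flat α) (find : β → ℕ) (x : α)
    (hleaves : ∀ c, leaves c = (fl c).2.length + 1)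
    (hfind : ∀ c, (fl c).inorder.Pairwise (· < ·) → find c = (fl c).find x) (c : β)
    (rest : List (α × β)) (hs : (flatNode fl c rest).inorder.Pairwise (· < ·)) :
    findChild leaves find x c rest = (flatNode fl c rest).find x := by
  induction rest generalizing c with
  | nil => exact hfind c hs
  | cons p rest ih =>
    obtain ⟨k, d⟩ := p
    simp only [flatNode, Flat.inorder_glue, List.pairwise_append, List.pairwise_cons] at hs
    obtain ⟨h1, ⟨h2, h3⟩, h4⟩ := hs
    rw [findChild, flatNode, Flat.find_glue _ _ _ _
      fun p hp => h4 _ (Flat.mem_inorder_of_separator hp) _ (by simp), hfind c h1, ih d h3,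
      hleaves]

theorem Level.leafIndex_eq_find (x : α) (h : ℕ) (t : Level α h)
    (hs : (Level.flat h t).inorder.Pairwise (· < ·)) :
    Level.leafIndex x h t = (Level.flat h t).find x := by
  induction h with
  | zero => rfl
  | succ h ih => exact findChild_eq_find _ _ _ _ (Level.leaves_eq h) ih _ _ hs

theorem Flat.find_lt_length_sizes (x : α) (t : Flat α) : t.find x < t.sizes.length := by
  obtain ⟨c, rest⟩ := t
  induction rest generalizing c with
  | nil => simp [Flat.find, Flat.sizes, findChild]
  | cons p rest ih =>
    obtain ⟨k, d⟩ := p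
    have := ih d
    simp only [Flat.find, Flat.sizes, List.length_cons, findChild] at this ⊢
    split_ifs
    · omega
    · simp only [List.map_cons, List.length_cons]; omega

/-! ### Sorted keys -/

theorem orderedInsert_append_of_lt (x : α) (l r : List α) (k : α) (h : x < k) :
    List.orderedInsert (· ≤ ·) x (l ++ k :: r) = List.orderedInsert (· ≤ ·) x l ++ k :: r := by
  induction l with
  | nil => simp [h.le]
  | cons a l ih =>
    simp only [List.cons_append, List.orderedInsert_cons, ih]
    split_ifs <;> simp

theorem orderedInsert_append_of_forall_lt (x : α) (l r : List α) (h : ∀ y ∈ l, y < x) :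
    List.orderedInsert (· ≤ ·) x (l ++ r) = l ++ List.orderedInsert (· ≤ ·) x r := by
  induction l with
  | nil => rfl
  | cons a l ih =>
    have ha : ¬ x ≤ a := not_le.2 (h a (by simp))
    simp [ha, ih fun y hy => h y (by simp [hy])]

theorem Flat.inorder_update_find (m : ℕ) (x : α) (t : Flat α)
    (hs : t.inorder.Pairwise (· < ·)) (hx : x ∉ t.inorder) :
    (Flat.update (fun l => splitLeaf m (List.orderedInsert (· ≤ ·) x l)) (t.find x) t).inorder =
      List.orderedInsert (· ≤ ·) x t.inorder := by
  obtain ⟨c, rest⟩ := t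
  induction rest generalizing c with
  | nil =>
    simp only [Flat.update, updateChild]
    rw [inorder_absorb_splitLeaf]
    simp [Flat.inorder]
  | cons p rest ih =>
    obtain ⟨k, d⟩ := p
    have e : ∀ (c d : List α) (k : α) (rest : List (α × List α)),
        Flat.inorder (c, (k, d) :: rest) = c ++ k :: Flat.inorder (d, rest) := fun _ _ _ _ => by
      simp [Flat.inorder]
    rw [e] at hs hx ⊢
    rw [List.pairwise_append, List.pairwise_cons] at hs
    obtain ⟨h1, ⟨h2, h3⟩, h4⟩ := hs
    simp only [List.mem_append, List.mem_cons, not_or] at hx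
    simp only [Flat.find, findChild]
    split_ifs with hk
    · simp only [Flat.update, updateChild, if_pos Nat.zero_lt_one]
      rw [inorder_absorb_splitLeaf, e, orderedInsert_append_of_lt _ _ _ _ hk]
    · have hk' : k < x := lt_of_le_of_ne (not_lt.1 hk) (Ne.symm hx.2.1)
      have := ih d h3 hx.2.2
      simp only [Flat.update, Flat.find] at this
      simp only [Flat.update, updateChild]
      rw [if_neg (by omega), Nat.add_sub_cancel_left, e, Prod.mk.eta, this,
        orderedInsert_append_of_forall_lt _ _ _ fun y hy => (h4 y hy k (by simp)).trans hk']
      simp [not_le.2 hk']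

theorem build_append_singleton (m : ℕ) (w : List α) (x : α) :
    build m (w ++ [x]) = insertKey m (build m w) x := by
  simp [build]

/-- The search tree invariant. It justifies replacing the search in the tree by the search in its
flattening, and it shows that the keys read from left to right are the inserted ones in sorted
order. -/
theorem inorder_build (m : ℕ) (w : List α) (hw : w.Nodup) :
    (KeyTree.flat (build m w)).inorder.Pairwise (· < ·) ∧
      (KeyTree.flat (build m w)).inorder.Perm w := by
  induction w using List.reverseRecOn with
  | nil => simp [build, emptyTree, KeyTree.flat, Level.flat, Flat.inorder]
  | append_singleton w x ih =>
    rw [List.nodup_append] at hw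
    obtain ⟨h1, h2⟩ := ih hw.1
    have hx : x ∉ w := fun h => hw.2.2 x h x (by simp) rfl
    have hx' : x ∉ (KeyTree.flat (build m w)).inorder := fun h => hx (h2.mem_iff.1 h)
    rw [build_append_singleton, insertKey, KeyTree.flat_insertAt, Level.leafIndex_eq_find _ _ _ h1]
    change ((Flat.update _ (Flat.find x (KeyTree.flat (build m w))) _).inorder.Pairwise _) ∧
      (Flat.update _ (Flat.find x (KeyTree.flat (build m w))) _).inorder.Perm _
    rw [Flat.inorder_update_find m x _ h1 hx']
    have hp : (List.orderedInsert (· ≤ ·) x (KeyTree.flat (build m w)).inorder).Perm (w ++ [x]) :=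
      (List.perm_orderedInsert _ _ _).trans
        ((h2.cons x).trans (List.perm_append_singleton x w).symm)
    refine ⟨?_, hp⟩
    have hle := List.Pairwise.orderedInsert (r := (· ≤ ·)) x _ (h1.imp le_of_lt)
    have hnd : (List.orderedInsert (· ≤ ·) x (KeyTree.flat (build m w)).inorder).Nodup :=
      hp.nodup_iff.2 (List.nodup_append.2 hw)
    exact hle.imp₂ (fun _ _ h h' => lt_of_le_of_ne h h') hnd

theorem leafIndex_build (m : ℕ) (w : List α) (hw : w.Nodup) (x : α) :
    Level.leafIndex x (build m w).1 (build m w).2 = (KeyTree.flat (build m w)).find x :=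
  Level.leafIndex_eq_find _ _ _ (inorder_build m w hw).1

end Flatten

section Naturality

/-! ### Relabelling the keys -/

variable {α α' β β' : Type}

/-- Relabel the keys of a node by `f`, and its children by `g`. -/
def mapNode (f : α → α') (g : β → β') (t : β × List (α × β)) : β' × List (α' × β') :=
  (g t.1, t.2.map fun p => (f p.1, g p.2))

/-- Relabel the outcome of an insertion. -/
def Grown.map (f : α → α') (g : β → β') : Grown α β → Grown α' β'
  | .single t => .single (g t)
  | .split l k r => .split (g l) (f k) (g r)

/-- Relabel the keys of a flattened tree. -/
abbrev Flat.map (f : α → α') (t : Flat α) : Flat α' := mapNode f (List.map f) t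

/-- Relabel the keys of a tree of any height. -/
def KeyTree.map (f : α → α') (T : KeyTree α) : KeyTree α' := ⟨T.1, Level.map f T.1 T.2⟩

theorem mapNode_absorb (f : α → α') (g : β → β') (G : Grown α β) (rest : List (α × β)) :
    mapNode f g (absorb G rest) =
      absorb (G.map f g) (rest.map fun p => (f p.1, g p.2)) := by
  cases G <;> rfl

theorem mapNode_updateChild (f : α → α') (g : β → β') (leaves : β → ℕ) (leaves' : β' → ℕ)
    (F : ℕ → β → Grown α β) (F' : ℕ → β' → Grown α' β')
    (hleaves : ∀ c, leaves' (g c) = leaves c) (hF : ∀ i c, (F i c).map f g = F' i (g c))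
    (i : ℕ) (c : β) (rest : List (α × β)) :
    mapNode f g (updateChild leaves F i c rest) =
      updateChild leaves' F' i (g c) (rest.map fun p => (f p.1, g p.2)) := by
  induction rest generalizing i c with
  | nil => simp [updateChild, mapNode_absorb, hF]
  | cons p rest ih =>
    obtain ⟨k, d⟩ := p
    simp only [updateChild, List.map_cons, hleaves]
    split_ifs
    · rw [mapNode_absorb, hF]; rfl
    · rw [← ih]; rfl

theorem map_splitNode (m : ℕ) (f : α → α') (g : β → β') (t : β × List (α × β)) :
    (splitNode m t).map f (mapNode f g) = splitNode m (mapNode f g t) := by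
  obtain ⟨c, rest⟩ := t
  simp only [splitNode, mapNode, List.length_map, ← List.map_drop, ← List.map_take]
  split_ifs
  · rfl
  · rcases rest.drop m with _ | ⟨⟨k, d⟩, r⟩ <;> rfl

theorem map_splitLeaf (m : ℕ) (f : α → α') (l : List α) :
    (splitLeaf m l).map f (List.map f) = splitLeaf m (l.map f) := by
  simp only [splitLeaf, List.length_map, ← List.map_drop, ← List.map_take]
  split_ifs
  · rfl
  · rcases l.drop m with _ | ⟨k, r⟩ <;> rfl

theorem Level.leaves_map (f : α → α') (h : ℕ) (t : Level α h) :
    Level.leaves h (Level.map f h t) = Level.leaves h t := by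
  induction h with
  | zero => rfl
  | succ h ih => simp [Level.leaves, Level.map, Function.comp_def, ih]

theorem Level.map_insertAt (m : ℕ) (f : α → α') (put : List α → List α)
    (put' : List α' → List α') (hput : ∀ l, (put l).map f = put' (l.map f)) (h i : ℕ)
    (t : Level α h) :
    (Level.insertAt m put h i t).map f (Level.map f h) =
      Level.insertAt m put' h i (Level.map f h t) := by
  induction h generalizing i with
  | zero =>
    refine (map_splitLeaf m f (put t)).trans ?_
    exact congrArg (splitLeaf m) (hput t)
  | succ h ih =>
    refine (map_splitNode m f (Level.map f h) _).trans ?_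
    rw [mapNode_updateChild f (Level.map f h) _ _ _ _ (Level.leaves_map f h) ih]
    rfl

theorem KeyTree.map_insertAt (m : ℕ) (f : α → α') (put : List α → List α)
    (put' : List α' → List α') (hput : ∀ l, (put l).map f = put' (l.map f)) (i : ℕ)
    (T : KeyTree α) :
    KeyTree.map f (insertAt m put i T) = insertAt m put' i (KeyTree.map f T) := by
  have := Level.map_insertAt m f put put' hput T.1 i T.2
  simp only [insertAt, KeyTree.map]
  rw [← this]
  cases Level.insertAt m put T.1 i T.2 <;> rfl

theorem Flat.map_glue (f : α → α') (t : Flat α) (k : α) (u : Flat α) :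
    Flat.map f (t.glue k u) = (Flat.map f t).glue (f k) (Flat.map f u) := by
  simp [Flat.glue, mapNode]

theorem Level.flat_map (f : α → α') (h : ℕ) (t : Level α h) :
    Level.flat h (Level.map f h t) = Flat.map f (Level.flat h t) := by
  induction h with
  | zero => rfl
  | succ h ih =>
    obtain ⟨c, rest⟩ := t
    simp only [Level.flat, Level.map]
    induction rest generalizing c with
    | nil => exact ih c
    | cons p rest ih' =>
      have := ih' p.2
      simp only [List.map_cons, flatNode, Flat.map_glue, ih, this]

theorem KeyTree.flat_map (f : α → α') (T : KeyTree α) :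
    KeyTree.flat (KeyTree.map f T) = Flat.map f (KeyTree.flat T) :=
  Level.flat_map f T.1 T.2

theorem Flat.sizes_map (f : α → α') (t : Flat α) : (Flat.map f t).sizes = t.sizes := by
  simp [Flat.sizes, mapNode, Function.comp_def]

theorem shape_eq_map (T : KeyTree α) : shape T = KeyTree.map (fun _ => ()) T := rfl

theorem sizes_shape (T : KeyTree α) :
    (KeyTree.flat (shape T)).sizes = (KeyTree.flat T).sizes := by
  rw [shape_eq_map, KeyTree.flat_map, Flat.sizes_map]

/-- A search depends only on the comparisons with the separators. This serves both monotone
relabelling and the passage from `Fin` to `ℕ`. -/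
theorem Flat.find_map_eq {γ δ : Type} [LinearOrder γ] [LinearOrder δ] (f : α → γ) (g : α → δ)
    (x : γ) (y : δ) (h : ∀ k, x < f k ↔ y < g k) (t : Flat α) :
    (Flat.map f t).find x = (Flat.map g t).find y := by
  obtain ⟨c, rest⟩ := t
  induction rest generalizing c with
  | nil => rfl
  | cons p rest ih =>
    have := ih p.2
    simp only [Flat.find, mapNode] at this
    simp only [Flat.find, mapNode, List.map_cons, findChild, h, this]

variable [LinearOrder α]

theorem shape_insertKey (m : ℕ) (T : KeyTree α) (x : α) :
    shape (insertKey m T x) = insertDot m (Level.leafIndex x T.1 T.2) (shape T) := by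
  refine KeyTree.map_insertAt m _ _ _ (fun l => ?_) _ T
  -- A list of dots is determined by its length, so the position inside the leaf is forgotten.
  refine List.ext_getElem (by simp [List.orderedInsert_length]) fun _ _ _ => rfl

variable [LinearOrder α']

theorem build_map (m : ℕ) (f : α → α') (hf : StrictMono f) (w : List α) (hw : w.Nodup) :
    build m (w.map f) = KeyTree.map f (build m w) := by
  induction w using List.reverseRecOn with
  | nil => rfl
  | append_singleton w x ih =>
    have hw' : w.Nodup := (List.nodup_append.1 hw).1
    rw [List.map_append, List.map_singleton, build_append_singleton, build_append_singleton,
      insertKey, leafIndex_build _ _ (hw'.map hf.injective), ih hw', insertKey,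
      leafIndex_build _ _ hw', KeyTree.flat_map,
      Flat.find_map_eq f id (f x) x (fun k => hf.lt_iff_lt),
      KeyTree.map_insertAt m f _ (List.orderedInsert (· ≤ ·) (f x))]
    · simp [mapNode]
    · intro l
      exact List.map_orderedInsert _ _ f l x (fun _ _ => hf.le_iff_le.symm)
        fun _ _ => hf.le_iff_le.symm

end Naturality

/-! ### Numbers of keys in the leaves -/

/-- The effect of an insertion into the leaf with index `i` on the list of the numbers of keys in
the leaves. -/
def step (m : ℕ) : List ℕ → ℕ → List ℕ
  | [], _ => []
  | c :: L, 0 => (if c + 1 ≤ 2 * m then [c + 1] else [m, c - m]) ++ L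
  | c :: L, i + 1 => c :: step m L i

theorem step_append_of_lt (m : ℕ) (A B : List ℕ) (i : ℕ) (hi : i < A.length) :
    step m (A ++ B) i = step m A i ++ B := by
  induction A generalizing i with
  | nil => simp at hi
  | cons c A ih =>
    cases i with
    | zero => simp [step]
    | succ i => simp [step, ih i (by simpa using hi)]

theorem step_append_length_add (m : ℕ) (A B : List ℕ) (i : ℕ) :
    step m (A ++ B) (A.length + i) = A ++ step m B i := by
  induction A with
  | nil => simp
  | cons c A ih =>
    rw [List.length_cons, Nat.add_right_comm]
    simp [step, ih]

theorem step_le (m : ℕ) (L : List ℕ) (i : ℕ) (hL : ∀ c ∈ L, c ≤ 2 * m) :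
    ∀ c ∈ step m L i, c ≤ 2 * m := by
  induction L generalizing i with
  | nil => simp [step]
  | cons a L ih =>
    have ha := hL a (by simp)
    have hL' : ∀ c ∈ L, c ≤ 2 * m := fun c hc => hL c (by simp [hc])
    cases i with
    | zero =>
      intro c hc
      simp only [step, List.mem_append] at hc
      rcases hc with hc | hc
      · split_ifs at hc <;> simp at hc <;> omega
      · exact hL' c hc
    | succ i =>
      intro c hc
      simp only [step, List.mem_cons] at hc
      rcases hc with rfl | hc
      · exact ha
      · exact ih i hL' c hc

/-- The first entry that changes is the one that was hit: it becomes `c + 1`, or it drops from `2 *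
m` to `m`, and these differ as `m ≥ 1`. -/
theorem step_injective (m : ℕ) (hm : 1 ≤ m) (L : List ℕ) (i j : ℕ) (hL : ∀ c ∈ L, c ≤ 2 * m)
    (hi : i < L.length) (hj : j < L.length) (h : step m L i = step m L j) : i = j := by
  induction L generalizing i j with
  | nil => simp at hi
  | cons a L ih =>
    have ha := hL a (by simp)
    have hL' : ∀ c ∈ L, c ≤ 2 * m := fun c hc => hL c (by simp [hc])
    rcases i with _ | i <;> rcases j with _ | j
    · rfl
    · simp only [step] at h
      split_ifs at h <;> simp at h
      all_goals omega
    · simp only [step] at h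
      split_ifs at h <;> simp at h
      all_goals omega
    · simp only [step, List.cons.injEq, true_and] at h
      rw [ih i j hL' (by simpa using hi) (by simpa using hj) h]

theorem sizes_absorb_splitLeaf {α : Type} (m : ℕ) (l : List α) (c : ℕ) (hl : l.length = c + 1)
    (rest : List (α × List α)) :
    Flat.sizes (absorb (splitLeaf m l) rest) =
      (if c + 1 ≤ 2 * m then [c + 1] else [m, c - m]) ++ rest.map fun p => p.2.length := by
  unfold splitLeaf
  rw [hl]
  split_ifs with h
  · simp [absorb, Flat.sizes, hl]
  · split
    · next h' =>
      have := congrArg List.length h'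
      simp at this
      omega
    · next k r h' =>
      have := congrArg List.length h'
      simp at this
      simp only [absorb, Flat.sizes, List.length_take, List.map_cons, List.cons_append,
        List.nil_append]
      congr 2 <;> omega

theorem Flat.sizes_update {α : Type} (m : ℕ) (put : List α → List α)
    (hput : ∀ l, (put l).length = l.length + 1) (i : ℕ) (t : Flat α) (hi : i < t.sizes.length) :
    (Flat.update (fun l => splitLeaf m (put l)) i t).sizes = step m t.sizes i := by
  obtain ⟨c, rest⟩ := t
  induction rest generalizing i c with
  | nil =>
    obtain rfl : i = 0 := by simpa [Flat.sizes] using hi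
    simp only [Flat.update, updateChild]
    rw [sizes_absorb_splitLeaf m _ _ (hput c)]
    rfl
  | cons p rest ih =>
    obtain ⟨k, d⟩ := p
    cases i with
    | zero =>
      simp only [Flat.update, updateChild, if_pos Nat.zero_lt_one]
      rw [sizes_absorb_splitLeaf m _ _ (hput c)]
      rfl
    | succ i =>
      have := ih i d (by simpa [Flat.sizes] using hi)
      simp only [Flat.update] at this
      simp only [Flat.update, updateChild]
      rw [if_neg (by omega), Nat.add_sub_cancel]
      have e : ∀ (c d : List α) (rest : List (α × List α)),
          Flat.sizes (c, (k, d) :: rest) = c.length :: Flat.sizes (d, rest) := fun _ _ _ => rfl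
      rw [e, e, Prod.mk.eta, this]
      rfl

/-! ### Histories given by leaf indices -/

/-- The history that arises by insertions into the leaves with indices `a 0`, `a 1`, …. -/
def dotHistory (m : ℕ) (a : ℕ → ℕ) : ℕ → KeyTree Unit
  | 0 => emptyTree Unit
  | k + 1 => insertDot m (a k) (dotHistory m a k)

/-- The numbers of keys in the leaves of a tree, from left to right. -/
def leafSizes {α : Type} (T : KeyTree α) : List ℕ := (KeyTree.flat T).sizes

theorem leafSizes_insertDot (m i : ℕ) (T : KeyTree Unit) (hi : i < (leafSizes T).length) :
    leafSizes (insertDot m i T) = step m (leafSizes T) i := by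
  rw [leafSizes, insertDot, KeyTree.flat_insertAt, Flat.sizes_update _ _ _ _ _ hi]
  · rfl
  · simp

theorem leafSizes_dotHistory_le (m : ℕ) (a : ℕ → ℕ) (k : ℕ)
    (ha : ∀ j < k, a j < (leafSizes (dotHistory m a j)).length) :
    ∀ c ∈ leafSizes (dotHistory m a k), c ≤ 2 * m := by
  induction k with
  | zero => simp [dotHistory, leafSizes, emptyTree, KeyTree.flat, Level.flat, Flat.sizes]
  | succ k ih =>
    rw [dotHistory, leafSizes_insertDot _ _ _ (ha k k.lt_succ_self)]
    exact step_le _ _ _ (ih fun j hj => ha j (hj.trans k.lt_succ_self))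

theorem shape_build_append_iff {α : Type} [LinearOrder α] (m : ℕ) (hm : 1 ≤ m) (a : ℕ → ℕ)
    (k : ℕ) (ha : ∀ j ≤ k, a j < (leafSizes (dotHistory m a j)).length) (w : List α)
    (hw : w.Nodup) (x : α) (h : shape (build m w) = dotHistory m a k) :
    shape (build m (w ++ [x])) = dotHistory m a (k + 1) ↔
      (KeyTree.flat (build m w)).find x = a k := by
  rw [build_append_singleton, shape_insertKey, dotHistory, h, leafIndex_build m w hw]
  refine ⟨fun e => ?_, fun e => by rw [e]⟩
  have hl : leafSizes (dotHistory m a k) = (KeyTree.flat (build m w)).sizes := by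
    rw [← h, leafSizes, sizes_shape]
  have hi : (KeyTree.flat (build m w)).find x < (leafSizes (dotHistory m a k)).length :=
    hl ▸ Flat.find_lt_length_sizes _ _
  have e' := congrArg leafSizes e
  rw [leafSizes_insertDot _ _ _ hi, leafSizes_insertDot _ _ _ (ha k le_rfl)] at e'
  exact step_injective m hm _ _ _
    (leafSizes_dotHistory_le m a k fun j hj => ha j hj.le) hi (ha k le_rfl) e'

/-! ### Counting the places for a new key -/

/-- Here `p` stands for the gap just before the key `p + 1`, since the search goes left at `k`
exactly when `p < k`. A leaf with `c` keys owns `c + 1` consecutive gaps. -/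
theorem card_filter_find_eq (a N i : ℕ) (t : Flat ℕ) (ht : t.inorder = List.range' (a + 1) N)
    (hi : i < t.sizes.length) :
    ((Finset.Icc a (a + N)).filter fun p => t.find p = i).card = t.sizes[i] + 1 := by
  obtain ⟨c, rest⟩ := t
  induction rest generalizing i a N c with
  | nil =>
    obtain rfl : i = 0 := by simpa [Flat.sizes] using hi
    have hc : c.length = N := by simpa [Flat.inorder] using congrArg List.length ht
    rw [Finset.filter_true_of_mem fun _ _ => by rfl]
    simp [Flat.sizes, hc]
    omega
  | cons p rest ih =>
    obtain ⟨k, d⟩ := p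
    have ht' : c ++ k :: Flat.inorder (d, rest) = List.range' (a + 1) N := by
      rw [← ht]; simp [Flat.inorder]
    rw [eq_comm, List.range'_eq_append_iff] at ht'
    obtain ⟨l, hl, hc, hr⟩ := ht'
    have hcl : c.length = l := by simp [hc]
    rw [eq_comm, List.range'_eq_cons_iff] at hr
    obtain ⟨hk, hpos, hr⟩ := hr
    simp only [Flat.find, findChild]
    cases i with
    | zero =>
      have : ((Finset.Icc a (a + N)).filter fun p =>
          (if p < k then 0 else 1 + findChild (fun _ => 1) (fun _ => 0) p d rest) = 0) =
          Finset.Icc a (a + l) := by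
        ext p
        simp only [Finset.mem_filter, Finset.mem_Icc]
        split_ifs <;> omega
      rw [this]
      simp [Flat.sizes, hcl]
      omega
    | succ i =>
      -- The first leaf, with `l` keys, owns the gaps `a, …, a + l`; dropping it and its separator
      -- `a + l + 1` shifts the range.
      have := ih (a + l + 1) (N - l - 1) i d (by rw [hr]; congr 1; omega)
        (by simpa [Flat.sizes] using hi)
      refine Eq.trans ?_ this
      congr 1
      ext p
      rw [Finset.mem_filter, Finset.mem_filter, Finset.mem_Icc, Finset.mem_Icc, Flat.find]
      by_cases hp : p < k
      · simp only [hp, if_true]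
        omega
      · simp only [hp, if_false]
        omega

theorem Fin.lt_succAbove_iff_val {n : ℕ} (p : Fin (n + 1)) (k : Fin n) :
    p < p.succAbove k ↔ (p : ℕ) < (k : ℕ) + 1 := by
  rw [Fin.lt_succAbove_iff_le_castSucc, Fin.le_def, Fin.val_castSucc, Nat.lt_succ_iff]

theorem card_filter_find_succAbove (n i : ℕ) (t : Flat (Fin n)) (ht : t.inorder = List.finRange n)
    (hi : i < t.sizes.length) :
    (Finset.univ.filter fun p : Fin (n + 1) => (Flat.map p.succAbove t).find p = i).card =
      t.sizes[i] + 1 := by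
  -- The shift by one turns `p < p.succAbove k` into a comparison with a key that does not depend on
  -- `p`.
  set u : Flat ℕ := Flat.map (fun k : Fin n => (k : ℕ) + 1) t with hu
  have hus : u.sizes = t.sizes := Flat.sizes_map _ _
  have hin : u.inorder = List.range' (0 + 1) n := by
    have : u.inorder = t.inorder.map fun k : Fin n => (k : ℕ) + 1 := by
      simp [hu, Flat.inorder, mapNode, List.map_flatMap, List.flatMap_map]
    rw [this, ht]
    refine List.ext_getElem (by simp) fun j _ _ => by simp [Nat.add_comm]
  have := card_filter_find_eq 0 n i u hin (by rwa [hus])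
  simp only [hus] at this
  rw [← this]
  refine Finset.card_bij (fun p _ => (p : ℕ)) ?_ (fun _ _ _ _ h => Fin.ext h) ?_
  · intro p hp
    simp only [Finset.mem_filter, Finset.mem_univ, true_and, Finset.mem_Icc] at hp ⊢
    refine ⟨⟨Nat.zero_le _, by omega⟩, ?_⟩
    rw [← hp, hu]
    exact Flat.find_map_eq _ _ _ _ (fun k => (Fin.lt_succAbove_iff_val p k).symm) t
  · intro q hq
    simp only [Finset.mem_filter, Finset.mem_Icc] at hq
    refine ⟨⟨q, by omega⟩, ?_, rfl⟩
    simp only [Finset.mem_filter, Finset.mem_univ, true_and]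
    refine Eq.trans ?_ hq.2
    exact Flat.find_map_eq _ _ _ _ (fun k => Fin.lt_succAbove_iff_val _ k) t

/-! ### The recursion for the number of key sequences -/

/-- The permutation with last value `p` whose other values are in the same relative order as
those of `σ`. -/
def insertLast {n : ℕ} (p : Fin (n + 1)) (σ : Equiv.Perm (Fin n)) : Equiv.Perm (Fin (n + 1)) :=
  (finSuccEquiv' (Fin.last n)).trans (σ.optionCongr.trans (finSuccEquiv' p).symm)

theorem insertLast_last {n : ℕ} (p : Fin (n + 1)) (σ : Equiv.Perm (Fin n)) :
    insertLast p σ (Fin.last n) = p := by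
  simp [insertLast]

theorem insertLast_castSucc {n : ℕ} (p : Fin (n + 1)) (σ : Equiv.Perm (Fin n)) (i : Fin n) :
    insertLast p σ i.castSucc = p.succAbove (σ i) := by
  have h := finSuccEquiv'_succAbove (Fin.last n) i
  rw [Fin.succAbove_last] at h
  simp [insertLast, h]

theorem insertLast_bijective (n : ℕ) : Function.Bijective
    fun x : Fin (n + 1) × Equiv.Perm (Fin n) => insertLast x.1 x.2 := by
  rw [Fintype.bijective_iff_injective_and_card]
  refine ⟨?_, by simp [Fintype.card_perm, Nat.factorial_succ]⟩
  rintro ⟨p, σ⟩ ⟨q, τ⟩ h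
  have hpq : p = q := by
    rw [← insertLast_last p σ, ← insertLast_last q τ]
    exact congrArg (fun e => e (Fin.last n)) h
  subst hpq
  congr 1
  ext i : 1
  have := congrArg (fun e : Equiv.Perm (Fin (n + 1)) => e i.castSucc) h
  simpa [insertLast_castSucc] using this

theorem ofFn_insertLast {n : ℕ} (p : Fin (n + 1)) (σ : Equiv.Perm (Fin n)) :
    List.ofFn (insertLast p σ) = (List.ofFn σ).map p.succAbove ++ [p] := by
  rw [List.ofFn_succ', List.concat_eq_append, insertLast_last]
  simp only [insertLast_castSucc, List.map_ofFn, Function.comp_def]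

theorem shape_map {α α' : Type} (f : α → α') (T : KeyTree α) :
    shape (KeyTree.map f T) = shape T := by
  have key : ∀ (h : ℕ) (t : Level α h),
      Level.map (fun _ => ()) h (Level.map f h t) = Level.map (fun _ => ()) h t := by
    intro h
    induction h with
    | zero => intro t; exact List.map_map
    | succ h ih => intro t; simp [Level.map, ih, Function.comp_def]; rfl
  simp [shape, KeyTree.map, key]

/-- The key sequence `π` has the members `T 0`, …, `T n` as its history. -/
def Produces (m n : ℕ) (T : ℕ → KeyTree Unit) (π : Equiv.Perm (Fin n)) : Prop :=
  ∀ k ≤ n, permHistory m π k = T k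

/-- The first `n` keys are those of `σ` under the strictly monotone `p.succAbove`, so they have the
same history; only the leaf of the last key remains to be prescribed. -/
theorem produces_insertLast_iff (m : ℕ) (hm : 1 ≤ m) (a : ℕ → ℕ) (n : ℕ)
    (ha : ∀ j ≤ n, a j < (leafSizes (dotHistory m a j)).length) (p : Fin (n + 1))
    (σ : Equiv.Perm (Fin n)) :
    Produces m (n + 1) (dotHistory m a) (insertLast p σ) ↔
      Produces m n (dotHistory m a) σ ∧
        (Flat.map p.succAbove (KeyTree.flat (build m (List.ofFn σ)))).find p = a n := by
  have hσ : (List.ofFn σ).Nodup := List.nodup_ofFn.2 σ.injective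
  have hmono : StrictMono p.succAbove := Fin.strictMono_succAbove p
  have hlow : ∀ k ≤ n, permHistory m (insertLast p σ) k = permHistory m σ k := by
    intro k hk
    rw [permHistory, permHistory, ofFn_insertLast, List.take_append_of_le_length (by simpa),
      ← List.map_take, build_map _ _ hmono _ (hσ.sublist (List.take_sublist _ _)), shape_map]
  have htop : permHistory m σ n = dotHistory m a n →
      (permHistory m (insertLast p σ) (n + 1) = dotHistory m a (n + 1) ↔
        (Flat.map p.succAbove (KeyTree.flat (build m (List.ofFn σ)))).find p = a n) := by
    intro h
    rw [permHistory, List.take_of_length_le (by simp)] at h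
    rw [permHistory, List.take_of_length_le (by simp), ofFn_insertLast,
      shape_build_append_iff m hm a n ha _ (hσ.map hmono.injective), build_map _ _ hmono _ hσ,
      KeyTree.flat_map]
    rw [build_map _ _ hmono _ hσ, shape_map, h]
  constructor
  · intro h
    have h' : Produces m n (dotHistory m a) σ := fun k hk => by
      rw [← hlow k hk, h k (by omega)]
    exact ⟨h', (htop (h' n le_rfl)).1 (h _ le_rfl)⟩
  · rintro ⟨h, h'⟩ k hk
    rcases Nat.lt_or_eq_of_le hk with hk | rfl
    · rw [hlow k (by omega), h k (by omega)]
    · exact (htop (h n le_rfl)).2 h'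

theorem inorder_build_ofFn (m : ℕ) {n : ℕ} (σ : Equiv.Perm (Fin n)) :
    (KeyTree.flat (build m (List.ofFn σ))).inorder = List.finRange n := by
  have hσ : (List.ofFn σ).Nodup := List.nodup_ofFn.2 σ.injective
  obtain ⟨h1, h2⟩ := inorder_build m _ hσ
  refine List.Perm.eq_of_pairwise' (r := (· < ·)) h1 (List.pairwise_lt_finRange n) (h2.trans ?_)
  refine (List.perm_ext_iff_of_nodup hσ (List.nodup_finRange n)).2 fun x => ?_
  exact ⟨fun _ => List.mem_finRange x, fun _ => List.mem_ofFn.2 (σ.surjective x)⟩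

/-- All `σ` with the given history lead to the same leaf sizes, so the number of admissible last
values `p` is the same for each of them. -/
theorem ncard_produces_succ (m : ℕ) (hm : 1 ≤ m) (a : ℕ → ℕ) (n : ℕ)
    (ha : ∀ j ≤ n, a j < (leafSizes (dotHistory m a j)).length) :
    {π | Produces m (n + 1) (dotHistory m a) π}.ncard =
      {σ | Produces m n (dotHistory m a) σ}.ncard *
        ((leafSizes (dotHistory m a n))[a n]'(ha n le_rfl) + 1) := by
  classical
  rw [Set.ncard_eq_toFinset_card', Set.ncard_eq_toFinset_card']
  set A := {σ | Produces m n (dotHistory m a) σ}.toFinset with hA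
  have hcard : ∀ σ ∈ A, (Finset.univ.filter fun p : Fin (n + 1) =>
      (Flat.map p.succAbove (KeyTree.flat (build m (List.ofFn σ)))).find p = a n).card =
        (leafSizes (dotHistory m a n))[a n]'(ha n le_rfl) + 1 := by
    intro σ hσ
    have h : Produces m n (dotHistory m a) σ := by simpa [hA] using hσ
    have hn := h n le_rfl
    rw [permHistory, List.take_of_length_le (by simp)] at hn
    have hs : (KeyTree.flat (build m (List.ofFn σ))).sizes = leafSizes (dotHistory m a n) := by
      rw [← hn, leafSizes, sizes_shape]
    rw [card_filter_find_succAbove n (a n) _ (inorder_build_ofFn m σ) (hs ▸ ha n le_rfl)]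
    simp only [hs]
  rw [← smul_eq_mul, ← Finset.sum_const, ← Finset.sum_congr rfl hcard, ← Finset.card_sigma]
  symm
  refine Finset.card_bij (fun x _ => insertLast x.2 x.1) ?_ ?_ ?_
  · rintro ⟨σ, p⟩ h
    simp only [Finset.mem_sigma, hA, Set.mem_toFinset, Set.mem_ofPred_eq, Finset.mem_filter,
      Finset.mem_univ, true_and] at h
    simpa using (produces_insertLast_iff m hm a n ha p σ).2 h
  · rintro ⟨σ, p⟩ _ ⟨τ, q⟩ _ h
    have := (insertLast_bijective n).1 (a₁ := (p, σ)) (a₂ := (q, τ)) h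
    simp only [Prod.mk.injEq] at this
    obtain ⟨rfl, rfl⟩ := this
    rfl
  · intro π hπ
    obtain ⟨⟨p, σ⟩, rfl⟩ := (insertLast_bijective n).2 π
    have h : Produces m (n + 1) (dotHistory m a) (insertLast p σ) := by simpa using hπ
    refine ⟨⟨σ, p⟩, ?_, rfl⟩
    simpa [hA] using (produces_insertLast_iff m hm a n ha p σ).1 h

/-! ### The product formula -/

/-- The factor contributed by a branching. -/
noncomputable def splitFactor (m : ℕ) : ℚ := ((2 * m + 1)! : ℚ) / ((m ! : ℚ) ^ 2)

theorem splitFactor_ne_zero (m : ℕ) : splitFactor m ≠ 0 := by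
  unfold splitFactor
  positivity

/-- The product over all leaves of the factorials of the numbers of keys, with one factor
`splitFactor m` for each leaf. -/
noncomputable def weight (m : ℕ) (L : List ℕ) : ℚ := (L.map fun c => splitFactor m * (c ! : ℚ)).prod

theorem weight_step (m : ℕ) (L : List ℕ) (i : ℕ) (hi : i < L.length) (hL : ∀ c ∈ L, c ≤ 2 * m) :
    weight m (step m L i) = weight m L * (L[i] + 1 : ℕ) := by
  induction L generalizing i with
  | nil => simp at hi
  | cons c L ih =>
    cases i with
    | zero =>
      simp only [step, weight, List.map_append, List.prod_append, List.map_cons, List.prod_cons,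
        List.getElem_cons_zero]
      split_ifs with h
      · simp only [List.map_cons, List.map_nil, List.prod_cons, List.prod_nil, Nat.factorial_succ]
        push_cast
        ring
      · obtain rfl : c = 2 * m := le_antisymm (hL c (by simp)) (by omega)
        have e : 2 * m - m = m := by omega
        simp only [List.map_cons, List.map_nil, List.prod_cons, List.prod_nil, e]
        -- This identity is what determines the value of `splitFactor`.
        have hK : splitFactor m * (m ! : ℚ) * (m ! : ℚ) = (2 * m + 1 : ℕ) * ((2 * m)! : ℚ) := by
          rw [← Nat.cast_mul, ← Nat.factorial_succ, splitFactor]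
          have : (m ! : ℚ) ≠ 0 := by positivity
          field_simp
        linear_combination
          splitFactor m * (L.map fun c => splitFactor m * (c ! : ℚ)).prod * hK
    | succ i =>
      have := ih i (by simpa using hi) fun c hc => hL c (by simp [hc])
      simp only [weight] at this
      simp only [step, weight, List.map_cons, List.prod_cons, this, List.getElem_cons_succ]
      ring

theorem ncard_produces (m : ℕ) (hm : 1 ≤ m) (a : ℕ → ℕ) (n : ℕ)
    (ha : ∀ j < n, a j < (leafSizes (dotHistory m a j)).length) :
    ({π | Produces m n (dotHistory m a) π}.ncard : ℚ) * splitFactor m =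
      weight m (leafSizes (dotHistory m a n)) := by
  induction n with
  | zero =>
    have : {π | Produces m 0 (dotHistory m a) π} = {Equiv.refl _} := by
      ext π
      simp only [Set.mem_ofPred_eq, Set.mem_singleton_iff]
      refine ⟨fun _ => Subsingleton.elim _ _, fun _ k hk => ?_⟩
      obtain rfl : k = 0 := by omega
      rfl
    rw [this]
    simp [weight, dotHistory, leafSizes, emptyTree, KeyTree.flat, Level.flat, Flat.sizes]
  | succ n ih =>
    have hn := ha n n.lt_succ_self
    rw [ncard_produces_succ m hm a n fun j hj => ha j (by omega), dotHistory,
      leafSizes_insertDot _ _ _ hn, weight_step _ _ _ hn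
        (leafSizes_dotHistory_le m a n fun j hj => ha j (by omega)),
      ← ih fun j hj => ha j (by omega)]
    push_cast
    ring

namespace HTree

/-! ### Leaf sizes encoded by a historic tree -/

/-- The numbers of keys in the leaves that correspond to the external vertices, from left to
right, if the leaf at the root starts with `c` keys. -/
def sizesFrom (m : ℕ) : ℕ → HTree → List ℕ
  | c, ext => [c]
  | c, plain _ t => sizesFrom m (c + 1) t
  | _, branching _ l r => sizesFrom m m l ++ sizesFrom m m r

theorem length_sizesFrom (m c : ℕ) (H : HTree) : (sizesFrom m c H).length = H.numExternal := by
  induction H generalizing c with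
  | ext => rfl
  | plain _ _ ih => exact ih _
  | branching _ _ _ ihl ihr => simp [sizesFrom, numExternal, ihl, ihr]

theorem numExternal_eq (H : HTree) : H.numExternal = H.numBranchings + 1 := by
  induction H with
  | ext => rfl
  | plain _ _ ih => exact ih
  | branching _ _ _ ihl ihr => simp only [numExternal, numBranchings, ihl, ihr]; omega

theorem length_spacingsFrom (s : ℕ) (H : HTree) : (spacingsFrom s H).length = H.numExternal := by
  induction H generalizing s with
  | ext => rfl
  | plain _ _ ih => exact ih _
  | branching _ _ _ ihl ihr => simp [spacingsFrom, numExternal, ihl, ihr]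

theorem sizesFrom_add_eq (m s : ℕ) (H : HTree) :
    sizesFrom m (m + s) H = (spacingsFrom s H).map (m + ·) := by
  induction H generalizing s with
  | ext => rfl
  | plain _ _ ih => exact ih (s + 1)
  | branching _ _ _ ihl ihr =>
    simp only [sizesFrom, spacingsFrom, List.map_append, ← ihl, ← ihr, add_zero]

/-- With a branching present, every external vertex lies below one, and there both counters restart:
the leaf at `m`, the spacing at `0`. The initial values are therefore irrelevant. -/
theorem sizesFrom_eq_of_numBranchings_pos (m c s : ℕ) (H : HTree) (h : 1 ≤ H.numBranchings) :
    sizesFrom m c H = (spacingsFrom s H).map (m + ·) := by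
  induction H generalizing c s with
  | ext => simp [numBranchings] at h
  | plain _ _ ih => exact ih _ _ h
  | branching _ l r =>
    simp only [sizesFrom, spacingsFrom, List.map_append, ← sizesFrom_add_eq, add_zero]

/-! ### Growing a historic tree by one vertex -/

theorem restrict_eq_ext (k : ℕ) (H : HTree) (h : ∀ v ∈ H.labels, k < v) : H.restrict k = ext := by
  cases H with
  | ext => rfl
  | plain a t => exact if_neg (not_le.2 (h a (by simp [labels])))
  | branching a l r => exact if_neg (not_le.2 (h a (by simp [labels])))

theorem restrict_eq_self (k : ℕ) (H : HTree) (h : ∀ v ∈ H.labels, v ≤ k) : H.restrict k = H := by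
  induction H with
  | ext => rfl
  | plain a t ih =>
    simp only [labels, List.mem_cons, forall_eq_or_imp] at h
    simp [restrict, h.1, ih h.2]
  | branching a l r ihl ihr =>
    simp only [labels, List.mem_cons, List.mem_append, forall_eq_or_imp] at h
    simp [restrict, h.1, ihl fun v hv => h.2 v (.inl hv), ihr fun v hv => h.2 v (.inr hv)]

theorem restrict_succ_of_notMem (k : ℕ) (H : HTree) (h : k + 1 ∉ H.labels) :
    H.restrict (k + 1) = H.restrict k := by
  induction H with
  | ext => rfl
  | plain a t ih =>
    simp only [labels, List.mem_cons, not_or] at h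
    have e : a ≤ k + 1 ↔ a ≤ k := by omega
    simp only [restrict, e, ih h.2]
  | branching a l r ihl ihr =>
    simp only [labels, List.mem_cons, List.mem_append, not_or] at h
    have e : a ≤ k + 1 ↔ a ≤ k := by omega
    simp only [restrict, e, ihl h.2.1, ihr h.2.2]

/-- The number `c` of keys in the leaf at an external vertex at height `h`. -/
def LeafAtHeight (m h c : ℕ) : Prop :=
  c ≤ 2 * m ∧ ∃ j : ℕ, h = c + j * (m + 1) ∧ (j = 0 ∨ m ≤ c)

/-- The number `j` counts the branchings above. Comparing `c + j * (m + 1)` with `2 * m + i * (m +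
1)`, the case `i < j` gives `c < m`, excluded because then `j ≠ 0`, and `i > j` gives `c > 2 * m`.
-/
theorem LeafAtHeight.isBranchingHeight_iff {m h c : ℕ} (H : LeafAtHeight m h c) :
    IsBranchingHeight m h ↔ c = 2 * m := by
  obtain ⟨hc, j, rfl, hj⟩ := H
  constructor
  · rintro ⟨i, hi⟩
    rcases lt_trichotomy i j with hij | rfl | hij
    · obtain ⟨d, rfl⟩ := Nat.exists_eq_add_of_lt hij
      have hj' : m ≤ c := by rcases hj with hj | hj <;> omega
      ring_nf at hi
      nlinarith
    · omega
    · obtain ⟨d, rfl⟩ := Nat.exists_eq_add_of_lt hij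
      ring_nf at hi
      nlinarith
  · rintro rfl
    exact ⟨j, rfl⟩

theorem LeafAtHeight.succ {m h c : ℕ} (H : LeafAtHeight m h c) (hb : ¬ IsBranchingHeight m h) :
    LeafAtHeight m (h + 1) (c + 1) := by
  rw [H.isBranchingHeight_iff] at hb
  obtain ⟨hc, j, rfl, hj⟩ := H
  exact ⟨by omega, j, by omega, by omega⟩

theorem LeafAtHeight.split {m h c : ℕ} (H : LeafAtHeight m h c) (hb : IsBranchingHeight m h) :
    LeafAtHeight m (h + 1) m := by
  rw [H.isBranchingHeight_iff] at hb
  obtain ⟨hc, j, rfl, hj⟩ := H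
  exact ⟨by omega, j + 1, by subst hb; ring, .inr le_rfl⟩

/-- Attaching a plain vertex adds a key to its leaf; attaching a branching happens precisely when
the leaf is full and replaces it by two leaves with `m` keys. Increasing labels make `k + 1` a new
bottom vertex, and subtrees without it do not change. -/
theorem sizesFrom_restrict_succ (m k h c : ℕ) (H : HTree) (hc : LeafAtHeight m h c)
    (hH : H.HeightCondition m h) (hinc : H.Increasing) (hnd : H.labels.Nodup)
    (hk : k + 1 ∈ H.labels) :
    H.attachIndex k < (H.restrict k).numExternal ∧
      sizesFrom m c (H.restrict (k + 1)) =
        step m (sizesFrom m c (H.restrict k)) (H.attachIndex k) := by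
  induction H generalizing h c with
  | ext => simp [labels] at hk
  | plain a t ih =>
    simp only [HeightCondition, Increasing, labels, List.nodup_cons, List.mem_cons] at hH hinc hnd hk
    by_cases ha : a = k + 1
    · subst ha
      have hb := hH.1
      rw [hc.isBranchingHeight_iff] at hb
      have h1 := hc.1
      simp only [restrict, attachIndex, if_true, le_refl, restrict_eq_ext _ _ hinc.1]
      rw [if_neg (by omega)]
      refine ⟨by simp [numExternal], ?_⟩
      simp only [sizesFrom, step]
      rw [if_pos (by omega)]
      rfl
    · have hk' : k + 1 ∈ t.labels := by
        rcases hk with hk | hk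
        · exact absurd hk.symm ha
        · exact hk
      have hlt := hinc.1 _ hk'
      have := ih (h + 1) (c + 1) (hc.succ hH.1) hH.2 hinc.2 hnd.2 hk'
      simp only [restrict, attachIndex]
      rw [if_neg ha, if_pos (show a ≤ k by omega), if_pos (show a ≤ k + 1 by omega)]
      exact this
  | branching a l r ihl ihr =>
    simp only [HeightCondition, Increasing, labels, List.nodup_cons, List.mem_cons,
      List.mem_append, List.nodup_append] at hH hinc hnd hk
    by_cases ha : a = k + 1
    · subst ha
      have hb := hH.1
      rw [hc.isBranchingHeight_iff] at hb
      simp only [restrict, attachIndex, if_true, le_refl, restrict_eq_ext _ _ hinc.1,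
        restrict_eq_ext _ _ hinc.2.1]
      rw [if_neg (by omega)]
      refine ⟨by simp [numExternal], ?_⟩
      simp only [sizesFrom, step]
      rw [if_neg (by omega)]
      simp only [List.cons_append, List.nil_append, List.append_nil, List.cons.injEq, true_and,
        and_true]
      omega
    · have hk' : k + 1 ∈ l.labels ∨ k + 1 ∈ r.labels := by
        rcases hk with hk | hk
        · exact absurd hk.symm ha
        · exact hk
      have hlt : a < k + 1 := hk'.elim (hinc.1 _) (hinc.2.1 _)
      have hc' := hc.split hH.1
      simp only [restrict, attachIndex]
      rw [if_neg ha, if_pos (show a ≤ k by omega), if_pos (show a ≤ k + 1 by omega)]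
      by_cases hl : k + 1 ∈ l.labels
      · obtain ⟨h1, h2⟩ := ihl (h + 1) m hc' hH.2.1 hinc.2.2.1 hnd.2.1 hl
        have hr : k + 1 ∉ r.labels := fun hr => hnd.2.2.2 _ hl _ hr rfl
        rw [if_pos hl]
        refine ⟨by simp only [numExternal]; omega, ?_⟩
        simp only [sizesFrom]
        rw [step_append_of_lt _ _ _ _ (by rwa [length_sizesFrom]), h2,
          restrict_succ_of_notMem k r hr]
      · obtain ⟨h1, h2⟩ := ihr (h + 1) m hc' hH.2.2 hinc.2.2.2 hnd.2.2.1 (hk'.resolve_left hl)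
        rw [if_neg hl]
        refine ⟨by simp only [numExternal]; omega, ?_⟩
        simp only [sizesFrom]
        rw [← length_sizesFrom m m, step_append_length_add, h2, restrict_succ_of_notMem k l hl]

/-! ### From historic trees to sequences of leaf indices -/

theorem history_eq_dotHistory (m : ℕ) (H : HTree) (k : ℕ) :
    H.history m k = dotHistory m (fun j => H.attachIndex j) k := by
  induction k with
  | zero => rfl
  | succ k ih => rw [history, dotHistory, ih]

theorem IsHistoric.leafSizes_dotHistory {m n : ℕ} {H : HTree} (hH : H.IsHistoric m n) (k : ℕ)
    (hk : k ≤ n) :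
    leafSizes (dotHistory m (fun j => H.attachIndex j) k) = sizesFrom m 0 (H.restrict k) := by
  induction k with
  | zero =>
    rw [restrict_eq_ext 0 H fun v hv => ((hH.mem_labels v).1 hv).1]
    rfl
  | succ k ih =>
    obtain ⟨h1, h2⟩ := sizesFrom_restrict_succ m k 0 0 H ⟨by omega, 0, by simp⟩ hH.heightCondition
      hH.increasing hH.nodup ((hH.mem_labels _).2 ⟨by omega, hk⟩)
    have ih := ih (by omega)
    rw [dotHistory, leafSizes_insertDot, h2, ih]
    rwa [ih, length_sizesFrom]

theorem IsHistoric.attachIndex_lt {m n : ℕ} {H : HTree} (hH : H.IsHistoric m n) (k : ℕ)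
    (hk : k < n) :
    H.attachIndex k < (leafSizes (dotHistory m (fun j => H.attachIndex j) k)).length := by
  rw [hH.leafSizes_dotHistory k hk.le, length_sizesFrom]
  exact (sizesFrom_restrict_succ m k 0 0 H ⟨by omega, 0, by simp⟩ hH.heightCondition
      hH.increasing hH.nodup ((hH.mem_labels _).2 ⟨by omega, hk⟩)).1

theorem perms_eq (m n : ℕ) (H : HTree) :
    H.perms m n = {π | Produces m n (dotHistory m fun j => H.attachIndex j) π} := by
  ext π
  simp only [perms, Produces, Set.mem_ofPred_eq, history_eq_dotHistory]
  refine ⟨fun h k hk => ?_, fun h k _ hk => h k hk⟩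
  -- `Produces` also covers index `0`, where both sides are the empty tree.
  rcases Nat.eq_zero_or_pos k with rfl | hk0
  · rfl
  · exact h k hk0 hk

end HTree

end BTreeHistory

theorem proposition3 (m n b : ℕ) (hm : 1 ≤ m) (H : BTreeHistory.HTree)
    (hH : H.IsHistoric m n) (hb : H.numBranchings = b) (hb1 : 1 ≤ b) :
    ∃ s : Fin (b + 1) → ℕ, List.ofFn s = H.spacings ∧
      ((H.perms m n).ncard : ℚ) =
        (((2 * m + 1)! : ℚ) / ((m ! : ℚ) ^ 2)) ^ b * ∏ i : Fin (b + 1), ((m + s i)! : ℚ) := by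
  open BTreeHistory in
  have hlen : H.spacings.length = b + 1 := by
    rw [HTree.spacings, HTree.length_spacingsFrom, HTree.numExternal_eq, hb]
  have hs : List.ofFn (fun i : Fin (b + 1) => H.spacings[(i : ℕ)]) = H.spacings :=
    List.ext_getElem (by simp [hlen]) fun _ _ _ => by simp only [List.getElem_ofFn]
  refine ⟨_, hs, ?_⟩
  have key := ncard_produces m hm (fun j => H.attachIndex j) n hH.attachIndex_lt
  rw [← HTree.perms_eq, hH.leafSizes_dotHistory n le_rfl,
    HTree.restrict_eq_self n H fun v hv => ((hH.mem_labels v).1 hv).2,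
    HTree.sizesFrom_eq_of_numBranchings_pos m 0 0 H (hb ▸ hb1), ← HTree.spacings, ← hs] at key
  -- The weight has one `splitFactor m` for each of the `b + 1` leaves; the surplus one belongs to
  -- the initial empty leaf.
  apply mul_right_cancel₀ (splitFactor_ne_zero m)
  rw [key, weight, List.map_map, List.map_ofFn, List.prod_ofFn]
  simp only [Function.comp_apply, Finset.prod_mul_distrib, Finset.prod_const, Finset.card_univ,
    Fintype.card_fin]
  rw [← splitFactor]
  ring
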